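/- Let $n\ge 2$ and let $\mathcal M\subset\mathbb R^n$ be a discrete $n$-manifold: a finite simplicial complex with vertices $v_1,\dots,v_N$ which is a union of $n$-simplices and whose underlying space is homeomorphic to the closed unit ball of $\mathbb R^n$. Let $\mathbb S_k(\mathcal M)$ be the set of its $k$-simplices. Let $\rho$ be a density that is constant and positive on each $n$-simplex, and put $\mu(\sigma)=\rho(\sigma)|\sigma|$ for $\sigma\in\mathbb S_n(\mathcal M)$, where $|\tau|$ denotes the $k$-dimensional volume of a $k$-simplex $\tau$. A matrix $\mathbf f\in\mathbb R^{N\times n}$ with rows $\mathbf f_1,\dots,\mathbf f_N$ induces the piecewise affine map $f:\mathcal M\to\mathbb R^n$ with $f(v_i)=\mathbf f_i$. For $i\neq j$ define $$w_{ij}(f)=\frac1{n(n-1)}\sum_{\sigma\in\mathbb S_n(\mathcal M),\ v_i,v_j\in\sigma}\frac{|f(\sigma_{\hat i\hat j})|}{\mu(\sigma)/|f(\sigma)|}\,\cot\theta^\sigma_{ij}(f),$$ where $\sigma_{\hat i\hat j}$ is the $(n-2)$-face of $\sigma$ spanned by the vertices of $\sigma$ other than $v_i,v_j$, and $\theta^\sigma_{ij}(f)$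 is the interior dihedral angle of the simplex $f(\sigma)$ between its two facets opposite to $\mathbf f_i$ and to $\mathbf f_j$. Let $L_V(f)\in\mathbb R^{N\times N}$ have entries $-w_{ij}(f)$ if $[v_i,v_j]\in\mathbb S_1(\mathcal M)$, $\sum_{\ell\ne i}w_{i\ell}(f)$ if $i=j$, and $0$ otherwise. The discrete $n$-dimensional volumetric stretch energy is $$E_V(f)=\frac1n\,\mathrm{trace}\big(\mathbf f^\top L_V(f)\,\mathbf f\big).$$ Theorem. At every $\mathbf f\in\mathbb R^{N\times n}$ for which all image simplices $f(\sigma)$, $\sigma\in\mathbb S_n(\mathcal M)$, are nondegenerate (have affinely independent vertices), $E_V$ is differentiable as a function of $\mathbf f$, and its gradient with respect to the Euclidean (Frobenius) inner product on $\mathbb R^{N\times n}$ is $$\nabla E_V(f)=2\,L_V(f)\,\mathbf f .$$ -/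

import Mathlib

open MeasureTheory

noncomputable section

/-- A discrete `n`-manifold with `N` vertices embedded in `ℝⁿ`: a finite simplicial complex, with
vertices enumerated as `v 0, …, v (N - 1)`, which is a union of `n`-simplices and whose underlying
space is homeomorphic to the closed unit ball of `ℝⁿ`. -/
structure DiscreteManifold (n N : ℕ) where
  /-- the enumeration of the vertices -/
  v : Fin N → EuclideanSpace ℝ (Fin n)
  v_injective : Function.Injective v
  /-- the underlying geometric simplicial complex -/
  complex : Geometry.SimplicialComplex ℝ (EuclideanSpace ℝ (Fin n))
  vertices_eq : complex.vertices = Set.range v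
  pure : ∀ s ∈ complex.faces, ∃ t ∈ complex.faces, s ⊆ t ∧ t.card = n + 1
  homeo_ball :
    Nonempty (complex.space ≃ₜ Metric.closedBall (0 : EuclideanSpace ℝ (Fin n)) 1)

/-- The simplex `[p i : i ∈ s]` spanned by the points `p i`, `i ∈ s`. -/
def simplexHull {n N : ℕ} (p : Fin N → EuclideanSpace ℝ (Fin n)) (s : Finset (Fin N)) :
    Set (EuclideanSpace ℝ (Fin n)) :=
  convexHull ℝ (p '' (s : Set (Fin N)))

/-- The `k`-dimensional volume of the `k`-simplex spanned by the `k + 1` points `p i`, `i ∈ s`. -/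
def simplexVol {n N : ℕ} (p : Fin N → EuclideanSpace ℝ (Fin n)) (s : Finset (Fin N)) : ℝ :=
  (μHE[s.card - 1] (simplexHull p s)).toReal

/-- The (interior) dihedral angle of the simplex `[p ℓ : ℓ ∈ s]` between its two facets opposite to
`p i` and to `p j`. These facets meet in the codimension-two face `F` spanned by
`s \ {i, j}`; they point away from `F` in the directions of the components orthogonal to `F` of
`p j` and of `p i`. These components are taken relative to the centroid of `F`, but any other
point of `F` gives the same vectors. -/
def dihedralAngle {n N : ℕ} (p : Fin N → EuclideanSpace ℝ (Fin n)) (s : Finset (Fin N))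
    (i j : Fin N) : ℝ :=
  InnerProductGeometry.angle
    ((vectorSpan ℝ (p '' ((s \ {i, j} : Finset (Fin N)) : Set (Fin N))))ᗮ.starProjection
      (p i - (s \ {i, j}).centroid ℝ p))
    ((vectorSpan ℝ (p '' ((s \ {i, j} : Finset (Fin N)) : Set (Fin N))))ᗮ.starProjection
      (p j - (s \ {i, j}).centroid ℝ p))

/-- The images `f(v i)` of the vertices, that is, the rows of the vertex image matrix. The
piecewise affine map induced by the matrix sends the simplex with vertices `v i`, `i ∈ s`, onto
`simplexHull (vertexImage f) s`. -/
def vertexImage {n N : ℕ} (f : Matrix (Fin N) (Fin n) ℝ) (i : Fin N) :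
    EuclideanSpace ℝ (Fin n) :=
  WithLp.toLp 2 (f.row i)

namespace DiscreteManifold

variable {n N : ℕ} (M : DiscreteManifold n N)

open Classical in
/-- The set of `k`-simplices of `M`, each given by the set of indices of its vertices. -/
def simplices (k : ℕ) : Finset (Finset (Fin N)) :=
  Finset.univ.filter fun s => s.card = k + 1 ∧ s.image M.v ∈ M.complex.faces

/-- The mass `μ(σ) = ρ(σ) |σ|` for a piecewise constant density `ρ`. -/
def mass (ρ : Finset (Fin N) → ℝ) (s : Finset (Fin N)) : ℝ :=
  ρ s * simplexVol M.v s

/-- The stretch factor `μ(σ) / |f(σ)|`. -/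
def stretchFactor (ρ : Finset (Fin N) → ℝ) (f : Matrix (Fin N) (Fin n) ℝ)
    (s : Finset (Fin N)) : ℝ :=
  M.mass ρ s / simplexVol (vertexImage f) s

/-- The modified cotangent weight of the edge `[v i, v j]`. -/
def weight (ρ : Finset (Fin N) → ℝ) (f : Matrix (Fin N) (Fin n) ℝ) (i j : Fin N) : ℝ :=
  1 / ((n : ℝ) * ((n : ℝ) - 1)) *
    ∑ s ∈ (M.simplices n).filter (fun s => i ∈ s ∧ j ∈ s),
      simplexVol (vertexImage f) (s \ {i, j}) / M.stretchFactor ρ f s *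
        Real.cot (dihedralAngle (vertexImage f) s i j)

open Classical in
/-- The volumetric stretch Laplacian matrix `L_V(f)`. -/
def laplacianV (ρ : Finset (Fin N) → ℝ) (f : Matrix (Fin N) (Fin n) ℝ) :
    Matrix (Fin N) (Fin N) ℝ :=
  Matrix.of fun i j =>
    if {i, j} ∈ M.simplices 1 then -M.weight ρ f i j
    else if i = j then ∑ l ∈ Finset.univ.erase i, M.weight ρ f i l
    else 0

/-- The discrete `n`-dimensional volumetric stretch energy `E_V(f)`. -/
def energyV (ρ : Finset (Fin N) → ℝ) (f : Matrix (Fin N) (Fin n) ℝ) : ℝ :=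
  1 / (n : ℝ) * (f.transpose * M.laplacianV ρ f * f).trace

end DiscreteManifold

end

/-! On an image simplex `f(σ)` with vertices `p i`, let `g i` be the gradient of the `i`-th
barycentric coordinate. Everything is expressed through these vectors.

The cotangent formula `simplexVol_mul_cot` gives `|F| cot θ = -n(n-1) |f(σ)| ⟪g i, g j⟫`, with `F`
the face opposite to the edge. Hence the weight `w_ij` is the sum of `-(|f(σ)|² / μ(σ)) ⟪g i, g j⟫`
over the simplices containing the edge. Since `∑ g j = 0` and `∑ ⟪g j, x⟫ p j = x`, row `i` of
`L_V(f) f` collapses to `∑ (|f(σ)|² / μ(σ)) g i`. Pairing the rows with the `p i` and using `∑ ⟪p i,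
g i⟫ = n` gives `E_V(f) = ∑ |f(σ)|² / μ(σ)`.

By Jacobi's formula, the gradient of `|f(σ)|²` in `p i` is `2 |f(σ)|² g i`. Differentiating the last
formula for `E_V` therefore gives twice row `i` of `L_V(f) f`. That formula is available where the
image simplices are nondegenerate, which is a neighbourhood condition. -/

open scoped RealInnerProductSpace

/-! ### Simplex volumes as Gram determinants -/

/-- The corner simplex `{x | 0 ≤ x, ∑ x ≤ r}` in `ℝᵏ` has volume `rᵏ / k!`. -/
theorem volume_cornerSimplex_fin (k : ℕ) (r : ℝ) (hr : 0 ≤ r) :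
    volume {x : Fin k → ℝ | (∀ i, 0 ≤ x i) ∧ ∑ i, x i ≤ r} =
      ENNReal.ofReal (r ^ k / k.factorial) := by
  induction k generalizing r with
  | zero =>
    have : {x : Fin 0 → ℝ | (∀ i, 0 ≤ x i) ∧ ∑ i, x i ≤ r} = Set.univ := by
      ext x; simp [hr]
    rw [this, volume_pi, Measure.pi_of_empty]
    simp
  | succ k ih =>
    have hmeas : MeasurableSet {z : ℝ × (Fin k → ℝ) |
        0 ≤ z.1 ∧ (∀ i, 0 ≤ z.2 i) ∧ z.1 + ∑ i, z.2 i ≤ r} := by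
      refine IsClosed.measurableSet ?_
      refine (isClosed_le continuous_const continuous_fst).and (IsClosed.and ?_ ?_)
      · rw [Set.ofPred_forall]
        exact isClosed_iInter fun i => isClosed_le continuous_const (by fun_prop)
      · exact isClosed_le (by fun_prop) continuous_const
    have hpre : {x : Fin (k + 1) → ℝ | (∀ i, 0 ≤ x i) ∧ ∑ i, x i ≤ r} =
        MeasurableEquiv.piFinSuccAbove (fun _ => ℝ) 0 ⁻¹' {z : ℝ × (Fin k → ℝ) |
        0 ≤ z.1 ∧ (∀ i, 0 ≤ z.2 i) ∧ z.1 + ∑ i, z.2 i ≤ r} := by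
      ext x
      simp [Fin.forall_fin_succ, Fin.sum_univ_succ, Fin.tail, and_assoc]
    rw [hpre, (volume_preserving_piFinSuccAbove (fun _ : Fin (k + 1) => ℝ) 0).measure_preimage
      hmeas.nullMeasurableSet, Measure.volume_eq_prod, Measure.prod_apply hmeas]
    -- Cavalieri: the slice at first coordinate `t` is the corner simplex of size `r - t`, which is
    -- why the induction runs over all `r`.
    have hslice : ∀ t : ℝ, volume (Prod.mk t ⁻¹' {z : ℝ × (Fin k → ℝ) |
        0 ≤ z.1 ∧ (∀ i, 0 ≤ z.2 i) ∧ z.1 + ∑ i, z.2 i ≤ r}) =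
        (Set.Icc 0 r).indicator (fun t => ENNReal.ofReal ((r - t) ^ k / k.factorial)) t := by
      intro t
      by_cases ht : t ∈ Set.Icc 0 r
      · rw [Set.indicator_of_mem ht, ← ih _ (sub_nonneg.2 ht.2)]
        congr 1
        ext y
        simp [ht.1, le_sub_iff_add_le']
      · rw [Set.indicator_of_notMem ht]
        convert measure_empty (μ := (volume : Measure (Fin k → ℝ)))
        ext y
        simp only [Set.mem_preimage, Set.mem_ofPred_eq, Set.mem_empty_iff_false, iff_false]
        rintro ⟨h1, h2, h3⟩
        exact ht ⟨h1, by linarith [Finset.sum_nonneg fun i (_ : i ∈ Finset.univ) => h2 i]⟩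
    simp_rw [hslice]
    rw [lintegral_indicator measurableSet_Icc, ← ofReal_integral_eq_lintegral_ofReal]
    · congr 1
      rw [integral_Icc_eq_integral_Ioc, ← intervalIntegral.integral_of_le hr,
        intervalIntegral.integral_comp_sub_left (fun t => t ^ k / (k.factorial : ℝ)) r]
      rw [intervalIntegral.integral_div, integral_pow, Nat.factorial_succ]
      simp only [sub_self, sub_zero, ne_eq, Nat.add_eq_zero_iff, one_ne_zero, and_false,
        not_false_eq_true, zero_pow]
      push_cast
      field_simp
    · exact (Continuous.continuousOn (by fun_prop)).integrableOn_Icc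
    · refine (ae_restrict_iff' measurableSet_Icc).2 (ae_of_all _ fun t ht => ?_)
      have := sub_nonneg.2 ht.2
      simp only [Pi.zero_apply]
      positivity

theorem volume_cornerSimplex (ι : Type*) [Fintype ι] :
    volume {x : EuclideanSpace ℝ ι | (∀ i, 0 ≤ x i) ∧ ∑ i, x i ≤ 1} =
      ENNReal.ofReal (1 / (Fintype.card ι).factorial) := by
  have e := Fintype.equivFin ι
  have h1 := volume_cornerSimplex_fin (Fintype.card ι) 1 zero_le_one
  rw [one_pow] at h1
  have hm : MeasurableSet {x : ι → ℝ | (∀ i, 0 ≤ x i) ∧ ∑ i, x i ≤ 1} := by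
    refine IsClosed.measurableSet (IsClosed.and ?_ (isClosed_le (by fun_prop) continuous_const))
    rw [Set.ofPred_forall]
    exact isClosed_iInter fun i => isClosed_le continuous_const (by fun_prop)
  have h2 := (volume_measurePreserving_piCongrLeft (fun _ => ℝ) e.symm).measure_preimage
    hm.nullMeasurableSet
  refine ((PiLp.volume_preserving_ofLp ι).measure_preimage hm.nullMeasurableSet).trans ?_
  rw [← h1, ← h2]
  · congr 1
    ext x
    have hx : ∀ i, (MeasurableEquiv.piCongrLeft (fun _ : ι => ℝ) e.symm) x i = x (e i) := by
      intro i
      obtain ⟨j, rfl⟩ := e.symm.surjective i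
      simp [MeasurableEquiv.coe_piCongrLeft, Equiv.piCongrLeft_apply_apply]
    simp only [Set.mem_preimage, Set.mem_ofPred_eq, hx]
    rw [e.sum_comp, ← e.forall_congr_right (q := fun i => 0 ≤ x i)]

theorem convexHull_insert_zero_basis (ι : Type*) [Fintype ι] [DecidableEq ι] :
    convexHull ℝ (insert 0 (Set.range fun i : ι => EuclideanSpace.single i (1 : ℝ))) =
      {x : EuclideanSpace ℝ ι | (∀ i, 0 ≤ x i) ∧ ∑ i, x i ≤ 1} := by
  apply Set.Subset.antisymm
  · refine convexHull_min ?_ ?_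
    · rintro x (rfl | ⟨i, rfl⟩)
      · simp
      · refine ⟨fun j => ?_, by simp⟩
        simp only [PiLp.single_apply]
        split_ifs <;> simp
    · intro x hx y hy a b ha hb hab
      refine ⟨fun i => ?_, ?_⟩
      · have := hx.1 i
        have := hy.1 i
        simp only [PiLp.add_apply, PiLp.smul_apply, smul_eq_mul]
        positivity
      · simp only [PiLp.add_apply, PiLp.smul_apply, smul_eq_mul, Finset.sum_add_distrib,
          ← Finset.mul_sum]
        nlinarith [hx.2, hy.2]
  · rintro x ⟨h0, h1⟩
    -- The vertex `0` takes up the slack `1 - ∑ x i` as its barycentric weight.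
    have hsum : x = ∑ o : Option ι, (o.elim (1 - ∑ i, x i) fun i => x i) •
        (o.elim 0 fun i => EuclideanSpace.single i (1 : ℝ)) := by
      ext j
      simp [Fintype.sum_option, Finset.sum_apply, Pi.single_apply]
    rw [hsum]
    refine (convex_convexHull ℝ _).sum_mem (fun o _ => ?_) ?_ fun o _ => subset_convexHull ℝ _ ?_
    · cases o
      · simpa using h1
      · simpa using h0 _
    · simp [Fintype.sum_option]
    · cases o <;> simp

/-- The volume of a simplex with a vertex at the origin, as a Gram determinant. -/
theorem euclideanHausdorffMeasure_convexHull_insert_zero {ι E : Type*} [Fintype ι] [DecidableEq ι]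
    [NormedAddCommGroup E] [InnerProductSpace ℝ E] [MeasurableSpace E]
    [BorelSpace E] (u : ι → E) :
    (μHE[Fintype.card ι] (convexHull ℝ (insert 0 (Set.range u)))).toReal =
      √(Matrix.gram ℝ u).det / (Fintype.card ι).factorial := by
  let b := EuclideanSpace.basisFun ι ℝ
  let T : EuclideanSpace ℝ ι →ₗ[ℝ] E := b.toBasis.constr ℝ u
  have hT : ∀ i, T (b i) = u i := fun i => by
    rw [← b.coe_toBasis]; exact b.toBasis.constr_basis ℝ u i
  have himg : convexHull ℝ (insert 0 (Set.range u)) =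
      T '' convexHull ℝ (insert 0 (Set.range fun i : ι => EuclideanSpace.single i (1 : ℝ))) := by
    rw [T.isLinear.image_convexHull, Set.image_insert_eq, map_zero, ← Set.range_comp]
    congr 3
    ext i
    rw [← hT i]
    simp [b]
  -- `E` may have larger dimension than `ι`, so `normDet` plays the role of `|det T|`.
  have hdet := T.normDet_sq_eq_det_gram b
  simp only [hT, RCLike.ofReal_real_eq_id, id] at hdet
  have h := T.euclideanHausdorffMeasure_image_eq_normDet_mul_volume
    {x : EuclideanSpace ℝ ι | (∀ i, 0 ≤ x i) ∧ ∑ i, x i ≤ 1}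
  rw [finrank_euclideanSpace] at h
  rw [himg, convexHull_insert_zero_basis, h, volume_cornerSimplex, ENNReal.toReal_mul,
    ENNReal.toReal_ofReal T.normDet_nonneg, ENNReal.toReal_ofReal (by positivity), ← hdet,
    Real.sqrt_sq T.normDet_nonneg]
  ring

/-- The volume of the simplex with vertices `p m` and `p (c a)` as a Gram determinant. -/
theorem simplexVol_eq_sqrt_det_gram {n N : ℕ} {ι : Type*} [Fintype ι] [DecidableEq ι]
    (p : Fin N → EuclideanSpace ℝ (Fin n)) (s : Finset (Fin N)) (m : Fin N) (c : ι → Fin N)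
    (hs : (s : Set (Fin N)) = insert m (Set.range c)) (hcard : s.card = Fintype.card ι + 1) :
    simplexVol p s =
      √(Matrix.gram ℝ fun a => p (c a) - p m).det / (Fintype.card ι).factorial := by
  rw [simplexVol, simplexHull, hs, hcard, Nat.add_sub_cancel,
    ← euclideanHausdorffMeasure_convexHull_insert_zero]
  congr 1
  have himg : p '' insert m (Set.range c) =
      (p m + ·) '' insert 0 (Set.range fun a => p (c a) - p m) := by
    rw [Set.image_insert_eq, Set.image_insert_eq, ← Set.range_comp, ← Set.range_comp]
    simp [Function.comp_def]
  rw [himg, ← (isometry_add_left (p m)).euclideanHausdorffMeasure_image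
    (convexHull ℝ (insert 0 (Set.range fun a => p (c a) - p m)))]
  congr 1
  exact ((AffineEquiv.constVAdd ℝ _ (p m)).toAffineMap.image_convexHull _).symm

/-! ### Cotangent weights through barycentric gradients -/

theorem gram_sum_smul {ι κ E : Type*} [Fintype ι] [NormedAddCommGroup E] [InnerProductSpace ℝ E]
    (A : Matrix κ ι ℝ) (v : ι → E) :
    Matrix.gram ℝ (fun k => ∑ i, A k i • v i) = A * Matrix.gram ℝ v * A.transpose := by
  ext k l
  simp only [Matrix.gram_apply, Matrix.mul_apply, Matrix.transpose_apply, sum_inner, inner_sum,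
    real_inner_smul_left, real_inner_smul_right, Finset.sum_mul]
  refine Finset.sum_congr rfl fun i _ => Finset.sum_congr rfl fun j _ => ?_
  rw [real_inner_comm]
  ring

/-- The Gram determinant of a family splits into that of a subfamily and that of the components
of the remaining vectors orthogonal to the subfamily. -/
theorem det_gram_sumElim {ι κ E : Type*} [Fintype ι] [Fintype κ] [DecidableEq ι] [DecidableEq κ]
    [NormedAddCommGroup E] [InnerProductSpace ℝ E] [FiniteDimensional ℝ E]
    (x : κ → E) (w : ι → E) :
    (Matrix.gram ℝ (Sum.elim x w)).det =
      (Matrix.gram ℝ fun k => (Submodule.span ℝ (Set.range w))ᗮ.starProjection (x k)).det *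
        (Matrix.gram ℝ w).det := by
  set W := Submodule.span ℝ (Set.range w) with hW
  have hC : ∀ k, ∃ C : ι → ℝ, ∑ i, C i • w i = x k - Wᗮ.starProjection (x k) := by
    intro k
    rw [← Submodule.mem_span_range_iff_exists_fun, ← hW]
    have := W.starProjection_add_starProjection_orthogonal (x k)
    rw [← eq_sub_iff_add_eq] at this
    rw [← this]
    exact W.starProjection_apply_mem _
  choose C hC using hC
  -- Removing the components along the span of `w` is a block unitriangular change of family, so the
  -- determinant is unchanged.
  have hsum : Sum.elim x w = fun k => ∑ i, Matrix.fromBlocks 1 (Matrix.of C) 0 1 k i •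
      Sum.elim (fun k => Wᗮ.starProjection (x k)) w i := by
    ext1 k
    rcases k with k | i
    · simp [hC, Matrix.one_apply]
    · simp [Matrix.one_apply]
  have hblock : Matrix.gram ℝ (Sum.elim (fun k => Wᗮ.starProjection (x k)) w) =
      Matrix.fromBlocks (Matrix.gram ℝ fun k => Wᗮ.starProjection (x k)) 0 0
        (Matrix.gram ℝ w) := by
    have h : ∀ k i, ⟪w i, Wᗮ.starProjection (x k)⟫ = 0 := fun k i =>
      (Submodule.mem_orthogonal _ _).1 (Wᗮ.starProjection_apply_mem (x k)) _
        (Submodule.subset_span ⟨i, rfl⟩)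
    ext k l
    rcases k with k | k <;> rcases l with l | l
    · rfl
    · exact (real_inner_comm _ _).trans (h k l)
    · exact h l k
    · rfl
  rw [hsum, gram_sum_smul, Matrix.det_mul, Matrix.det_mul, Matrix.det_transpose, hblock,
    Matrix.det_fromBlocks_zero₂₁, Matrix.det_fromBlocks_zero₂₁]
  simp

/-- The cotangent of the angle between two linearly independent vectors. -/
theorem cot_angle_eq {E : Type*} [NormedAddCommGroup E] [InnerProductSpace ℝ E] (a b : E)
    (ha : a ≠ 0) (hb : b ≠ 0) :
    Real.cot (InnerProductGeometry.angle a b) =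
      ⟪a, b⟫ / √(⟪a, a⟫ * ⟪b, b⟫ - ⟪a, b⟫ * ⟪a, b⟫) := by
  have ha := norm_pos_iff.2 ha
  have hb := norm_pos_iff.2 hb
  rw [Real.cot_eq_cos_div_sin, ← InnerProductGeometry.sin_angle_mul_norm_mul_norm,
    ← InnerProductGeometry.cos_angle_mul_norm_mul_norm a b,
    mul_div_mul_right _ _ (mul_pos ha hb).ne']

/-- Two dual pairs in a plane: the relation between their inner products. -/
theorem inner_dual_pair {E : Type*} [NormedAddCommGroup E] [InnerProductSpace ℝ E] {a b g h : E}
    (hg : g = ⟪g, g⟫ • a + ⟪h, g⟫ • b) (h1 : ⟪g, a⟫ = 1) (h2 : ⟪g, b⟫ = 0) :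
    ⟪h, g⟫ * (⟪a, a⟫ * ⟪b, b⟫ - ⟪a, b⟫ * ⟪a, b⟫) = -⟪a, b⟫ := by
  -- Pairing the expansion of `g` with `a` and with `b` gives two linear equations, from which `⟪g,
  -- g⟫` is eliminated.
  have e1 := congrArg (fun z => ⟪z, a⟫) hg
  have e2 := congrArg (fun z => ⟪z, b⟫) hg
  simp only [inner_add_left, real_inner_smul_left, h1, h2, real_inner_comm a b] at e1 e2
  linear_combination ⟪a, b⟫ * e1 - ⟪a, a⟫ * e2

/-- Barycentric gradients of a nondegenerate `n`-simplex in `ℝⁿ`: the gradients `g i` of its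
barycentric coordinates. -/
structure IsBarycentricGradient {n N : ℕ} (p : Fin N → EuclideanSpace ℝ (Fin n))
    (s : Finset (Fin N)) (g : Fin N → EuclideanSpace ℝ (Fin n)) : Prop where
  inner_sub : ∀ i ∈ s, ∀ k ∈ s, ∀ l ∈ s,
    ⟪g i, p k - p l⟫ = (if i = k then 1 else 0) - (if i = l then 1 else 0)
  sum_inner_smul : ∀ x, ∑ j ∈ s, ⟪g j, x⟫ • p j = x
  sum_eq_zero : ∑ j ∈ s, g j = 0

/-- The cotangent weight of an edge of a nondegenerate simplex in terms of the gradients of the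
barycentric coordinates. -/
theorem IsBarycentricGradient.simplexVol_mul_cot {n N : ℕ} {p : Fin N → EuclideanSpace ℝ (Fin n)}
    {s : Finset (Fin N)} {g : Fin N → EuclideanSpace ℝ (Fin n)}
    (hg : IsBarycentricGradient p s g) (hn : 2 ≤ n) (hs : s.card = n + 1)
    (hV : simplexVol p s ≠ 0) {i j : Fin N} (hi : i ∈ s) (hj : j ∈ s) (hij : i ≠ j) :
    simplexVol p (s \ {i, j}) * Real.cot (dihedralAngle p s i j) =
      -(n * (n - 1) * simplexVol p s * ⟪g i, g j⟫) := by
  classical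
  set F := s \ {i, j} with hF
  have hFcard : F.card + 2 = n + 1 := by
    rw [hF, Finset.card_sdiff_of_subset (by simp [Finset.insert_subset_iff, hi, hj]),
      Finset.card_pair hij, hs]
    omega
  obtain ⟨m, hm⟩ : F.Nonempty := Finset.card_pos.1 (by omega)
  have hFs : ∀ l ∈ F, l ∈ s ∧ l ≠ i ∧ l ≠ j := by
    intro l hl
    simpa [hF] using hl
  have hιcard : Fintype.card (F.erase m) + 2 = n := by
    rw [Fintype.card_coe, Finset.card_erase_of_mem hm]; omega
  set w : F.erase m → EuclideanSpace ℝ (Fin n) := fun l => p l - p m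
  set W := vectorSpan ℝ (p '' (F : Set (Fin N))) with hWdef
  have hWspan : Submodule.span ℝ (Set.range w) = W := by
    rw [hWdef, vectorSpan_eq_span_vsub_set_right ℝ (Set.mem_image_of_mem p (Finset.mem_coe.2 hm)),
      ← Set.image_comp]
    apply le_antisymm
    · refine Submodule.span_mono ?_
      rintro _ ⟨l, rfl⟩
      exact ⟨l, Finset.mem_of_mem_erase l.2, rfl⟩
    · refine Submodule.span_le.2 ?_
      rintro _ ⟨l, hl, rfl⟩
      by_cases hlm : l = m
      · simp [hlm]
      · exact Submodule.subset_span ⟨⟨l, Finset.mem_erase.2 ⟨hlm, hl⟩⟩, rfl⟩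
  have hzero : ∀ z ∈ W, Wᗮ.starProjection z = 0 := fun z hz =>
    Wᗮ.starProjection_apply_eq_zero_iff.2 (W.le_orthogonal_orthogonal hz)
  have hFm : ∀ l ∈ F, p l - p m ∈ W := fun l hl =>
    vsub_mem_vectorSpan ℝ (Set.mem_image_of_mem p hl) (Set.mem_image_of_mem p hm)
  have hq : F.centroid ℝ p - p m ∈ W := by
    refine vsub_mem_vectorSpan_of_mem_affineSpan_of_mem_affineSpan ?_
      (subset_affineSpan ℝ _ (Set.mem_image_of_mem p hm))
    exact affineCombination_mem_affineSpan_image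
      (F.sum_centroidWeights_eq_one_of_nonempty ℝ ⟨m, hm⟩) (by simp +contextual) p
  -- The centroid may be replaced by the vertex `m`: their difference lies in `W`, which the
  -- projection kills.
  have hproj : ∀ l, Wᗮ.starProjection (p l - F.centroid ℝ p) =
      Wᗮ.starProjection (p l - p m) := by
    intro l
    rw [← sub_eq_zero, ← map_sub, sub_sub_sub_cancel_left, ← neg_sub, map_neg, hzero _ hq,
      neg_zero]
  have hgW : ∀ l ∈ s, l ∉ F → g l ∈ Wᗮ := by
    intro l hl hlF
    rw [← hWspan, Submodule.mem_orthogonal]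
    intro z hz
    induction hz using Submodule.span_induction with
    | mem z hz =>
      obtain ⟨k, rfl⟩ := hz
      have hk := Finset.mem_of_mem_erase k.2
      rw [real_inner_comm, hg.inner_sub l hl k (hFs k hk).1 m (hFs m hm).1, if_neg, if_neg, sub_zero]
      · rintro rfl; exact hlF hm
      · rintro rfl; exact hlF hk
    | zero => simp
    | add x y _ _ hx hy => rw [inner_add_left, hx, hy, add_zero]
    | smul c x _ hx => rw [real_inner_smul_left, hx, mul_zero]
  have hiF : i ∉ F := by simp [hF]
  have hjF : j ∉ F := by simp [hF]
  have hinner : ∀ l ∈ s, l ∉ F → ∀ z, ⟪g l, Wᗮ.starProjection z⟫ = ⟪g l, z⟫ := by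
    intro l hl hlF z
    rw [← Submodule.inner_starProjection_left_eq_right,
      Submodule.starProjection_eq_self_iff.2 (hgW l hl hlF)]
  set a := Wᗮ.starProjection (p i - p m) with ha
  set b := Wᗮ.starProjection (p j - p m) with hb
  have hmi : i ≠ m := fun h => (hFs m hm).2.1 h.symm
  have hmj : j ≠ m := fun h => (hFs m hm).2.2 h.symm
  have hgia : ⟪g i, a⟫ = 1 := by
    rw [hinner i hi hiF, hg.inner_sub i hi i hi m (hFs m hm).1]; simp [hmi]
  have hgib : ⟪g i, b⟫ = 0 := by
    rw [hinner i hi hiF, hg.inner_sub i hi j hj m (hFs m hm).1]; simp [hmi, hij]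
  have hgjb : ⟪g j, b⟫ = 1 := by
    rw [hinner j hj hjF, hg.inner_sub j hj j hj m (hFs m hm).1]; simp [hmj]
  have hsF : s = insert i (insert j F) := by
    ext l
    simp only [hF, Finset.mem_insert, Finset.mem_sdiff, Finset.mem_singleton]
    constructor
    · intro h; tauto
    · rintro (rfl | rfl | h) <;> tauto
  -- Expand `g i` by the reproducing identity and project to `Wᗮ`: the vertices of `F` drop out,
  -- leaving a relation in the normal plane.
  have hgi : g i = ⟪g i, g i⟫ • a + ⟪g j, g i⟫ • b := by
    have h1 : g i = ∑ l ∈ s, ⟪g l, g i⟫ • (p l - p m) := by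
      simp only [smul_sub]
      rw [Finset.sum_sub_distrib, ← Finset.sum_smul, ← sum_inner, hg.sum_eq_zero,
        hg.sum_inner_smul]
      simp
    have h2 := congrArg Wᗮ.starProjection h1
    rw [Submodule.starProjection_eq_self_iff.2 (hgW i hi hiF), map_sum, hsF,
      Finset.sum_insert (by simp [hiF, hij]), Finset.sum_insert hjF,
      Finset.sum_eq_zero, add_zero, map_smul, map_smul] at h2
    · exact h2
    · intro l hl
      rw [map_smul, hzero _ (hFm l hl), smul_zero]
  have hdual := inner_dual_pair hgi hgia hgib
  have ha0 : a ≠ 0 := by rintro h; simp [h] at hgia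
  have hb0 : b ≠ 0 := by rintro h; simp [h] at hgjb
  set D := ⟪a, a⟫ * ⟪b, b⟫ - ⟪a, b⟫ * ⟪a, b⟫ with hD
  have hVF : simplexVol p F =
      √(Matrix.gram ℝ w).det / (Fintype.card (F.erase m)).factorial := by
    refine simplexVol_eq_sqrt_det_gram p F m (fun l : F.erase m => (l : Fin N)) ?_ ?_
    · rw [Subtype.range_coe_subtype]
      ext l
      by_cases h : l = m <;> simp [h, hm]
    · rw [Fintype.card_coe, Finset.card_erase_of_mem hm]; omega
  -- The Gram determinant splits as that of the plane pair `a, b`, namely `D`, times that of the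
  -- face `F`.
  have hVs : simplexVol p s =
      √(D * (Matrix.gram ℝ w).det) / (Fintype.card (Fin 2 ⊕ F.erase m)).factorial := by
    rw [simplexVol_eq_sqrt_det_gram p s m (Sum.elim ![i, j] fun l : F.erase m => (l : Fin N))]
    · have hfun : (fun k => p (Sum.elim ![i, j] (fun l : F.erase m => (l : Fin N)) k) - p m) =
          Sum.elim ![p i - p m, p j - p m] w := by
        ext1 k
        rcases k with k | k
        · fin_cases k <;> rfl
        · rfl
      rw [hfun, det_gram_sumElim, hWspan, Matrix.det_fin_two]
      simp only [Matrix.gram_apply, Matrix.cons_val_zero, Matrix.cons_val_one]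
      rw [← ha, ← hb, real_inner_comm a b]
    · rw [hsF, Set.Sum.elim_range]
      ext l
      by_cases h : l = m
      · simp [h, hm]
      · simp [h, or_assoc, or_comm]
    · simp only [Fintype.card_sum, Fintype.card_fin, hs]; omega
  have hDpos : 0 ≤ D := by
    have := real_inner_mul_inner_self_le a b
    linarith
  -- The ratio `n! / (n-2)!` is the source of the factor `n (n - 1)`.
  have hfact : ((Fintype.card (Fin 2 ⊕ F.erase m)).factorial : ℝ) =
      n * (n - 1) * (Fintype.card (F.erase m)).factorial := by
    rw [Fintype.card_sum, Fintype.card_fin, add_comm, ← hιcard, Nat.factorial_succ,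
      Nat.factorial_succ]
    push_cast
    ring
  have hD0 : D ≠ 0 := by
    intro h
    rw [h] at hVs
    simp at hVs
    exact hV hVs
  have hsq : √D ≠ 0 := (Real.sqrt_pos.2 (lt_of_le_of_ne hDpos hD0.symm)).ne'
  have hfac0 : ((Fintype.card (F.erase m)).factorial : ℝ) ≠ 0 := by positivity
  have hn0 : (n : ℝ) ≠ 0 := by positivity
  have hn1 : (n : ℝ) - 1 ≠ 0 := by
    have : (2 : ℝ) ≤ n := by exact_mod_cast hn
    linarith
  have hcot : ⟪a, b⟫ / √D = -(⟪g j, g i⟫ * √D) := by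
    rw [div_eq_iff hsq, ← neg_eq_iff_eq_neg.2 hdual, neg_mul, mul_assoc, Real.mul_self_sqrt hDpos]
  rw [dihedralAngle, hproj, hproj, cot_angle_eq _ _ ha0 hb0, hcot, hVF, hVs, hfact,
    Real.sqrt_mul hDpos, real_inner_comm (g j) (g i)]
  field_simp

/-! ### The derivative of the squared volume -/

/-- The determinant as a continuous multilinear map of the rows. -/
def Matrix.detCMM (n : ℕ) : ContinuousMultilinearMap ℝ (fun _ : Fin n => Fin n → ℝ) ℝ where
  toMultilinearMap := Matrix.detRowAlternating.toMultilinearMap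
  cont := by
    change Continuous fun A : Fin n → Fin n → ℝ => Matrix.det (Matrix.of A)
    exact Continuous.matrix_det continuous_id

/-- Jacobi's formula: each term replaces one row of `A`, and Cramer's rule expresses its determinant
by cofactors. -/
theorem Matrix.detCMM_linearDeriv {n : ℕ} (A B : Fin n → Fin n → ℝ) :
    (Matrix.detCMM n).linearDeriv A B = ∑ r, ∑ a, (Matrix.of A).adjugate a r * B r a := by
  rw [ContinuousMultilinearMap.linearDeriv_apply]
  refine Finset.sum_congr rfl fun r _ => ?_
  change ((Matrix.of A).updateRow r (B r)).det = _
  rw [← Matrix.cramer_transpose_apply, Matrix.cramer_eq_adjugate_mulVec,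
    ← Matrix.adjugate_transpose]
  rfl

theorem exists_eq_insert_image_fin {N n : ℕ} {s : Finset (Fin N)} (hs : s.card = n + 1) :
    ∃ (m : Fin N) (c : Fin n → Fin N), Function.Injective c ∧ (∀ r, c r ≠ m) ∧
      s = insert m (Finset.univ.image c) := by
  obtain ⟨m, t, hmt, rfl, ht⟩ := Finset.card_eq_succ.1 hs
  refine ⟨m, t.orderEmbOfFin ht, (t.orderEmbOfFin ht).injective, fun r h => hmt ?_, ?_⟩
  · rw [← h]; exact t.orderEmbOfFin_mem ht r
  · rw [Finset.image_orderEmbOfFin_univ]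

/-- The edge vectors `p (c r) - p m`, as the rows of a square matrix. -/
noncomputable def edgeMatrixCLM {n N : ℕ} (m : Fin N) (c : Fin n → Fin N) :
    (Fin N → EuclideanSpace ℝ (Fin n)) →L[ℝ] (Fin n → Fin n → ℝ) :=
  ContinuousLinearMap.pi fun r => ContinuousLinearMap.pi fun a =>
    (EuclideanSpace.proj a).comp
      (ContinuousLinearMap.proj (R := ℝ) (φ := fun _ : Fin N => EuclideanSpace ℝ (Fin n)) (c r) -
        ContinuousLinearMap.proj m)

theorem edgeMatrixCLM_apply {n N : ℕ} (m : Fin N) (c : Fin n → Fin N)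
    (p : Fin N → EuclideanSpace ℝ (Fin n)) (r a : Fin n) :
    edgeMatrixCLM m c p r a = p (c r) a - p m a := rfl

/-- Squaring removes the absolute value, so the squared volume is a polynomial in the vertices,
differentiable without any case distinction. -/
theorem simplexVol_sq_eq_det_sq {n N : ℕ} (m : Fin N) (c : Fin n → Fin N)
    (hc : Function.Injective c) (hm : ∀ r, c r ≠ m) (p : Fin N → EuclideanSpace ℝ (Fin n)) :
    simplexVol p (insert m (Finset.univ.image c)) ^ 2 =
      (Matrix.of (edgeMatrixCLM m c p)).det ^ 2 / (n.factorial : ℝ) ^ 2 := by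
  have hgram : (Matrix.gram ℝ fun r => p (c r) - p m) =
      Matrix.of (edgeMatrixCLM m c p) * (Matrix.of (edgeMatrixCLM m c p)).transpose := by
    ext r t
    simp [Matrix.gram_apply, Matrix.mul_apply, PiLp.inner_apply, edgeMatrixCLM_apply, mul_comm]
  rw [simplexVol_eq_sqrt_det_gram p _ m c, hgram, Matrix.det_mul, Matrix.det_transpose, div_pow,
    Real.sq_sqrt (mul_self_nonneg _), Fintype.card_fin, sq (Matrix.det _)]
  · simp
  · rw [Finset.card_insert_of_notMem (by simpa using hm), Finset.card_image_of_injective _ hc]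
    simp

theorem simplexVol_ne_zero {n N : ℕ} {p : Fin N → EuclideanSpace ℝ (Fin n)}
    {s : Finset (Fin N)} (hs : s.card = n + 1)
    (hp : AffineIndependent ℝ fun i : s => p i) : simplexVol p s ≠ 0 := by
  obtain ⟨m, c, hc, hm, rfl⟩ := exists_eq_insert_image_fin hs
  have hmem : ∀ r, c r ∈ insert m (Finset.univ.image c) := by simp
  have hli := (affineIndependent_iff_linearIndependent_vsub ℝ _
    (⟨m, Finset.mem_insert_self _ _⟩ : ↥(insert m (Finset.univ.image c)))).1 hp
  have hli' : LinearIndependent ℝ fun r => p (c r) - p m :=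
    hli.comp (fun r => ⟨⟨c r, hmem r⟩, fun h => hm r (congrArg Subtype.val h)⟩) fun r t h =>
      hc (congrArg (fun z => (z.1 : Fin N)) h)
  rw [simplexVol_eq_sqrt_det_gram p _ m c (by simp) (by simpa using hs)]
  have := (Matrix.posDef_gram_of_linearIndependent hli').det_pos
  positivity

/-- A nondegenerate simplex has barycentric gradients, and they give the derivative of its squared
volume. -/
theorem exists_isBarycentricGradient {n N : ℕ} {p : Fin N → EuclideanSpace ℝ (Fin n)}
    {s : Finset (Fin N)} (hs : s.card = n + 1) (hV : simplexVol p s ≠ 0) :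
    ∃ g, IsBarycentricGradient p s g ∧
      HasFDerivAt (fun q : Fin N → EuclideanSpace ℝ (Fin n) => simplexVol q s ^ 2)
        ((2 * simplexVol p s ^ 2) • ∑ i ∈ s,
          (innerSL ℝ (g i)).comp (ContinuousLinearMap.proj i)) p := by
  obtain ⟨m, c, hc, hm, rfl⟩ := exists_eq_insert_image_fin hs
  have hmim : m ∉ Finset.univ.image c := by simpa using hm
  have hdet : (Matrix.of (edgeMatrixCLM m c p)).det ≠ 0 := by
    intro h
    have := simplexVol_sq_eq_det_sq m c hc hm p
    rw [h] at this
    simp [hV] at this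
  set A := Matrix.of (edgeMatrixCLM m c p) with hA
  -- `h r` is column `r` of `A⁻¹`, hence dual to the edge vectors, the rows of `A`. The value at `m`
  -- in the next line is forced by `∑ g j = 0`.
  let h : Fin n → EuclideanSpace ℝ (Fin n) := fun r => WithLp.toLp 2 fun a => A⁻¹ a r
  let g : Fin N → EuclideanSpace ℝ (Fin n) := Function.extend c h fun _ => -∑ r, h r
  have hgc : ∀ r, g (c r) = h r := fun r => hc.extend_apply _ _ r
  have hgm : g m = -∑ r, h r :=
    Function.extend_apply' _ _ _ (by rintro ⟨r, hr⟩; exact hm r hr)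
  have hsum : ∀ {M : Type} [AddCommMonoid M] (F : Fin N → M),
      ∑ i ∈ insert m (Finset.univ.image c), F i = F m + ∑ r, F (c r) := by
    intro M _ F
    rw [Finset.sum_insert hmim, Finset.sum_image hc.injOn]
  have hmul : A * A⁻¹ = 1 := Matrix.mul_nonsing_inv A hdet.isUnit
  have hmul' : A⁻¹ * A = 1 := Matrix.nonsing_inv_mul A hdet.isUnit
  have hrow : ∀ r t, ⟪h r, p (c t) - p m⟫ = if r = t then 1 else 0 := by
    intro r t
    have := congrFun (congrFun hmul t) r
    rw [Matrix.mul_apply, Matrix.one_apply] at this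
    simp only [eq_comm (a := r), ← this, PiLp.inner_apply]
    exact Finset.sum_congr rfl fun a _ => rfl
  have hbase : ∀ i ∈ insert m (Finset.univ.image c), ∀ k ∈ insert m (Finset.univ.image c),
      ⟪g i, p k - p m⟫ = (if i = k then 1 else 0) - (if i = m then 1 else 0) := by
    intro i hi k hk
    rcases Finset.mem_insert.1 hk with rfl | hk
    · simp
    obtain ⟨t, -, rfl⟩ := Finset.mem_image.1 hk
    rcases Finset.mem_insert.1 hi with rfl | hi
    · rw [hgm, inner_neg_left, sum_inner]
      simp [hrow, (hm t).symm]
    · obtain ⟨r, -, rfl⟩ := Finset.mem_image.1 hi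
      rw [hgc, hrow]
      simp [hc.eq_iff, hm r]
  refine ⟨g, ⟨?_, ?_, ?_⟩, ?_⟩
  · intro i hi k hk l hl
    rw [← sub_sub_sub_cancel_right (p k) (p l) (p m), inner_sub_right, hbase i hi k hk,
      hbase i hi l hl]
    ring
  · intro x
    rw [hsum, hgm, inner_neg_left, sum_inner, neg_smul, Finset.sum_smul, ← sub_eq_neg_add,
      ← Finset.sum_sub_distrib]
    simp only [hgc, ← smul_sub]
    ext b
    -- Duality came from `A * A⁻¹ = 1`; the reproducing identity comes from `A⁻¹ * A = 1`.
    have hx : x b = ∑ a, x a * (A⁻¹ * A) a b := by simp [hmul', Matrix.one_apply]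
    simp only [WithLp.ofLp_sum, Finset.sum_apply, PiLp.smul_apply, smul_eq_mul, hx,
      Matrix.mul_apply, Finset.mul_sum]
    rw [Finset.sum_comm]
    refine Finset.sum_congr rfl fun r _ => ?_
    rw [PiLp.inner_apply, Finset.sum_mul]
    refine Finset.sum_congr rfl fun a _ => ?_
    rw [← mul_assoc]
    rfl
  · rw [hsum, hgm]
    simp [hgc]
  · have h1 := ((Matrix.detCMM n).hasFDerivAt (edgeMatrixCLM m c p)).comp p
      (edgeMatrixCLM m c).hasFDerivAt
    have h2 := (h1.pow 2).mul_const ((n.factorial : ℝ) ^ 2)⁻¹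
    have hfun : (fun q : Fin N → EuclideanSpace ℝ (Fin n) =>
        simplexVol q (insert m (Finset.univ.image c)) ^ 2) = fun q =>
        (Matrix.detCMM n (edgeMatrixCLM m c q)) ^ 2 * ((n.factorial : ℝ) ^ 2)⁻¹ :=
      funext fun q => simplexVol_sq_eq_det_sq m c hc hm q
    rw [hfun]
    refine h2.congr_fderiv ?_
    ext v
    -- The cofactors in Jacobi's formula are `det A` times the entries of `A⁻¹`, that is, of the
    -- barycentric gradients.
    have hAdj : ∀ a r, A.adjugate a r = A.det * h r a := by
      intro a r
      change _ = A.det * A⁻¹ a r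
      rw [Matrix.inv_def, Matrix.smul_apply, smul_eq_mul, Ring.inverse_eq_inv',
        mul_inv_cancel_left₀ hdet]
    have hlin : (Matrix.detCMM n).linearDeriv (edgeMatrixCLM m c p) (edgeMatrixCLM m c v) =
        A.det * ∑ i ∈ insert m (Finset.univ.image c), ⟪g i, v i⟫ := by
      rw [Matrix.detCMM_linearDeriv, hsum, hgm, inner_neg_left, sum_inner, ← sub_eq_neg_add,
        ← Finset.sum_sub_distrib, Finset.mul_sum]
      refine Finset.sum_congr rfl fun r _ => ?_
      rw [hgc, ← inner_sub_right, PiLp.inner_apply, Finset.mul_sum]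
      refine Finset.sum_congr rfl fun a _ => ?_
      rw [← hA, hAdj, mul_assoc, edgeMatrixCLM_apply]
      congr 1
      exact mul_comm _ _
    have hdetA : Matrix.detCMM n (edgeMatrixCLM m c p) = A.det := rfl
    rw [simplexVol_sq_eq_det_sq m c hc hm p]
    simp only [smul_apply, ContinuousLinearMap.comp_apply,
      sum_apply, ContinuousLinearMap.proj_apply, innerSL_apply_apply,
      Function.comp_apply, hlin, hdetA, smul_eq_mul]
    simp
    ring

/-! ### Identities for barycentric gradients -/

/-- The `p i` terms cancel because `∑ g j = 0`; the `p j` terms are the reproducing identity at `x =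
g i`. This is one simplex's contribution to a row of `L_V(f) f`, up to the factor `|f(σ)|² / μ(σ)`.
-/
theorem IsBarycentricGradient.sum_erase {n N : ℕ} {p : Fin N → EuclideanSpace ℝ (Fin n)}
    {s : Finset (Fin N)} {g : Fin N → EuclideanSpace ℝ (Fin n)}
    (hg : IsBarycentricGradient p s g) (i : Fin N) :
    ∑ j ∈ s.erase i, (-⟪g i, g j⟫) • (p i - p j) = g i := by
  rw [Finset.sum_erase _ (by simp)]
  simp only [smul_sub, neg_smul, sub_neg_eq_add, Finset.sum_add_distrib, Finset.sum_neg_distrib,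
    ← Finset.sum_smul, ← inner_sum, hg.sum_eq_zero, inner_zero_right, zero_smul, neg_zero]
  rw [zero_add]
  simpa [real_inner_comm] using hg.sum_inner_smul (g i)

/-- Both sides are the trace of the identity map `x ↦ ∑ ⟪g j, x⟫ p j`. -/
theorem IsBarycentricGradient.sum_inner {n N : ℕ} {p : Fin N → EuclideanSpace ℝ (Fin n)}
    {s : Finset (Fin N)} {g : Fin N → EuclideanSpace ℝ (Fin n)}
    (hg : IsBarycentricGradient p s g) : ∑ i ∈ s, ⟪p i, g i⟫ = n := by
  have h : ∀ a : Fin n, ∑ i ∈ s, g i a * p i a = 1 := by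
    intro a
    have := congrArg (fun z : EuclideanSpace ℝ (Fin n) => z a)
      (hg.sum_inner_smul (EuclideanSpace.single a 1))
    simpa [EuclideanSpace.inner_single_right] using this
  simp only [PiLp.inner_apply, RCLike.inner_apply, conj_trivial]
  rw [Finset.sum_comm]
  simp [h]

/-! ### The Laplacian and the energy on the complex -/

namespace DiscreteManifold

variable {n N : ℕ} (M : DiscreteManifold n N) (ρ : Finset (Fin N) → ℝ)

theorem pair_mem_simplices_one {k : ℕ} {s : Finset (Fin N)} (hs : s ∈ M.simplices k) {i j : Fin N}
    (hi : i ∈ s) (hj : j ∈ s) (hij : i ≠ j) : {i, j} ∈ M.simplices 1 := by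
  classical
  simp only [simplices, Finset.mem_filter, Finset.mem_univ, true_and] at hs ⊢
  refine ⟨Finset.card_pair hij, ?_⟩
  refine M.complex.down_closed (s := s.image M.v) ?_ ?_ (by simp)
  · convert hs.2
  · refine (Finset.image_subset_image ?_).trans (le_of_eq (by congr))
    simp [Finset.insert_subset_iff, hi, hj]

theorem card_of_mem_simplices {k : ℕ} {s : Finset (Fin N)} (hs : s ∈ M.simplices k) :
    s.card = k + 1 := by
  simp only [simplices, Finset.mem_filter] at hs
  exact hs.2.1

/-- When `i, j` do not span an edge, no `n`-simplex contains both, so the weight is an empty sum and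
the edge condition can be dropped. -/
theorem laplacianV_apply_of_ne (f : Matrix (Fin N) (Fin n) ℝ) {i j : Fin N} (hij : i ≠ j) :
    M.laplacianV ρ f i j = -M.weight ρ f i j := by
  simp only [laplacianV, Matrix.of_apply]
  split_ifs with h
  · convert rfl
  · rw [weight, Finset.filter_eq_empty_iff.2, Finset.sum_empty, mul_zero, neg_zero]
    exact fun s hs hsij => h (by
      convert M.pair_mem_simplices_one hs hsij.1 hsij.2 hij)

theorem laplacianV_apply_self (f : Matrix (Fin N) (Fin n) ℝ) (i : Fin N) :
    M.laplacianV ρ f i i = ∑ l ∈ Finset.univ.erase i, M.weight ρ f i l := by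
  simp only [laplacianV, Matrix.of_apply]
  rw [if_neg, if_pos trivial]
  intro h
  have := M.card_of_mem_simplices h
  simp at this

theorem laplacianV_mul_apply (f : Matrix (Fin N) (Fin n) ℝ) (i : Fin N) (a : Fin n) :
    (M.laplacianV ρ f * f) i a =
      ∑ j ∈ Finset.univ.erase i, M.weight ρ f i j * (f i a - f j a) := by
  rw [Matrix.mul_apply, ← Finset.add_sum_erase _ _ (Finset.mem_univ i), laplacianV_apply_self,
    Finset.sum_mul, ← Finset.sum_add_distrib]
  refine Finset.sum_congr rfl fun j hj => ?_
  rw [M.laplacianV_apply_of_ne ρ f (Finset.ne_of_mem_erase hj).symm]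
  ring

variable {f : Matrix (Fin N) (Fin n) ℝ}
  {g : Finset (Fin N) → Fin N → EuclideanSpace ℝ (Fin n)}

theorem weight_eq (hn : 2 ≤ n)
    (hV : ∀ s ∈ M.simplices n, simplexVol (vertexImage f) s ≠ 0)
    (hg : ∀ s ∈ M.simplices n, IsBarycentricGradient (vertexImage f) s (g s))
    {i j : Fin N} (hij : i ≠ j) :
    M.weight ρ f i j = ∑ s ∈ (M.simplices n).filter (fun s => i ∈ s ∧ j ∈ s),
      simplexVol (vertexImage f) s ^ 2 / M.mass ρ s * (-⟪g s i, g s j⟫) := by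
  have hn0 : (n : ℝ) ≠ 0 := by positivity
  have hn1 : (n : ℝ) - 1 ≠ 0 := by
    have : (2 : ℝ) ≤ n := by exact_mod_cast hn
    linarith
  rw [weight, Finset.mul_sum]
  refine Finset.sum_congr rfl fun s hs => ?_
  obtain ⟨hs, hi, hj⟩ := Finset.mem_filter.1 hs
  have h := (hg s hs).simplexVol_mul_cot hn (M.card_of_mem_simplices hs) (hV s hs) hi hj hij
  calc _ = 1 / ((n : ℝ) * (n - 1)) * (simplexVol (vertexImage f) s / M.mass ρ s) *
        (simplexVol (vertexImage f) (s \ {i, j}) *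
          Real.cot (dihedralAngle (vertexImage f) s i j)) := by
        rw [stretchFactor, div_div_eq_mul_div]; ring
    _ = _ := by rw [h]; field_simp

/-- Exchange the sums over vertices and simplices, then apply `sum_erase` in each simplex. -/
theorem laplacianV_mul_apply_eq (hn : 2 ≤ n)
    (hV : ∀ s ∈ M.simplices n, simplexVol (vertexImage f) s ≠ 0)
    (hg : ∀ s ∈ M.simplices n, IsBarycentricGradient (vertexImage f) s (g s))
    (i : Fin N) (a : Fin n) :
    (M.laplacianV ρ f * f) i a = ∑ s ∈ (M.simplices n).filter (fun s => i ∈ s),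
      simplexVol (vertexImage f) s ^ 2 / M.mass ρ s * g s i a := by
  rw [laplacianV_mul_apply]
  have h1 : ∀ j ∈ Finset.univ.erase i, M.weight ρ f i j * (f i a - f j a) =
      ∑ s ∈ M.simplices n, if i ∈ s ∧ j ∈ s then simplexVol (vertexImage f) s ^ 2 / M.mass ρ s *
        (-⟪g s i, g s j⟫ * (f i a - f j a)) else 0 := by
    intro j hj
    rw [M.weight_eq ρ hn hV hg (Finset.ne_of_mem_erase hj).symm, Finset.sum_mul,
      ← Finset.sum_filter]
    exact Finset.sum_congr rfl fun s _ => mul_assoc _ _ _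
  rw [Finset.sum_congr rfl h1, Finset.sum_comm, Finset.sum_filter]
  refine Finset.sum_congr rfl fun s hs => ?_
  split_ifs with hi
  · simp only [hi, true_and]
    have h2 := congrArg (fun z : EuclideanSpace ℝ (Fin n) => z a) ((hg s hs).sum_erase i)
    simp only [WithLp.ofLp_sum, Finset.sum_apply, PiLp.smul_apply, PiLp.sub_apply,
      smul_eq_mul] at h2
    rw [← h2, Finset.mul_sum, ← Finset.sum_filter]
    refine Finset.sum_congr ?_ fun j _ => rfl
    ext j
    simp
  · simp [hi]

/-- The energy is the sum of the squared image volumes relative to the masses. -/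
theorem energyV_eq (hn : 2 ≤ n)
    (hV : ∀ s ∈ M.simplices n, simplexVol (vertexImage f) s ≠ 0) :
    M.energyV ρ f = ∑ s ∈ M.simplices n, simplexVol (vertexImage f) s ^ 2 / M.mass ρ s := by
  have hn0 : (n : ℝ) ≠ 0 := by positivity
  have hex : ∀ s, ∃ g, s ∈ M.simplices n → IsBarycentricGradient (vertexImage f) s g := by
    intro s
    by_cases hs : s ∈ M.simplices n
    · obtain ⟨g, hg, -⟩ := exists_isBarycentricGradient (M.card_of_mem_simplices hs) (hV s hs)
      exact ⟨g, fun _ => hg⟩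
    · exact ⟨0, fun h => absurd h hs⟩
  choose g hg using hex
  have htr : (f.transpose * M.laplacianV ρ f * f).trace =
      ∑ i, ∑ s ∈ M.simplices n, if i ∈ s then
        simplexVol (vertexImage f) s ^ 2 / M.mass ρ s * ⟪vertexImage f i, g s i⟫ else 0 := by
    rw [Matrix.mul_assoc, Matrix.trace]
    simp only [Matrix.diag_apply, Matrix.mul_apply (M := f.transpose), Matrix.transpose_apply,
      M.laplacianV_mul_apply_eq ρ hn hV hg]
    rw [Finset.sum_comm]
    refine Finset.sum_congr rfl fun i _ => ?_
    simp only [Finset.mul_sum]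
    rw [Finset.sum_comm, Finset.sum_filter]
    refine Finset.sum_congr rfl fun s _ => ?_
    congr 1
    rw [PiLp.inner_apply, Finset.mul_sum]
    refine Finset.sum_congr rfl fun a _ => ?_
    change f i a * _ = _ * (g s i a * f i a)
    ring
  rw [energyV, htr, Finset.sum_comm, Finset.mul_sum]
  refine Finset.sum_congr rfl fun s hs => ?_
  rw [← Finset.sum_filter, Finset.filter_univ_mem, ← Finset.mul_sum, (hg s hs).sum_inner]
  field_simp

end DiscreteManifold

/-! ### The gradient of the energy -/

/-- The vertex images as a linear function of the vectorized vertex image matrix. -/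
noncomputable def vertexImageCLM (n N : ℕ) :
    EuclideanSpace ℝ (Fin n × Fin N) →L[ℝ] Fin N → EuclideanSpace ℝ (Fin n) :=
  ContinuousLinearMap.pi fun i => (EuclideanSpace.equiv (Fin n) ℝ).symm.toContinuousLinearMap.comp
    (ContinuousLinearMap.pi fun a => EuclideanSpace.proj (a, i))

theorem mainTheorem4 {n N : ℕ} (hn : 2 ≤ n) (M : DiscreteManifold n N)
    (ρ : Finset (Fin N) → ℝ) (hρ : ∀ s ∈ M.simplices n, 0 < ρ s)
    (f : Matrix (Fin N) (Fin n) ℝ)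
    (hf : ∀ s ∈ M.simplices n, AffineIndependent ℝ (fun i : s => vertexImage f i)) :
    HasGradientAt
      (fun x : EuclideanSpace ℝ (Fin n × Fin N) => M.energyV ρ (Matrix.of fun i a => x (a, i)))
      (WithLp.toLp 2 (Matrix.vec ((2 : ℝ) • (M.laplacianV ρ f * f))))
      (WithLp.toLp 2 (Matrix.vec f)) := by
  have hV : ∀ s ∈ M.simplices n, simplexVol (vertexImage f) s ≠ 0 := fun s hs =>
    simplexVol_ne_zero (M.card_of_mem_simplices hs) (hf s hs)
  -- `Matrix.vec` stacks columns, so coordinate `(a, i)` of `x₀` is `f i a`.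
  set x₀ : EuclideanSpace ℝ (Fin n × Fin N) := WithLp.toLp 2 (Matrix.vec f)
  have hex : ∀ s, ∃ g, s ∈ M.simplices n → IsBarycentricGradient (vertexImage f) s g ∧
      HasFDerivAt (fun q : Fin N → EuclideanSpace ℝ (Fin n) => simplexVol q s ^ 2)
        ((2 * simplexVol (vertexImage f) s ^ 2) • ∑ i ∈ s,
          (innerSL ℝ (g i)).comp (ContinuousLinearMap.proj i)) (vertexImage f) := by
    intro s
    by_cases hs : s ∈ M.simplices n
    · obtain ⟨g, hg⟩ := exists_isBarycentricGradient (M.card_of_mem_simplices hs) (hV s hs)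
      exact ⟨g, fun _ => hg⟩
    · exact ⟨0, fun h => absurd h hs⟩
  choose g hg using hex
  have hder : ∀ s ∈ M.simplices n, HasFDerivAt (fun x : EuclideanSpace ℝ (Fin n × Fin N) =>
      simplexVol (vertexImageCLM n N x) s ^ 2)
      (((2 * simplexVol (vertexImage f) s ^ 2) • ∑ i ∈ s,
        (innerSL ℝ (g s i)).comp (ContinuousLinearMap.proj i)).comp (vertexImageCLM n N)) x₀ :=
    fun s hs => HasFDerivAt.comp (g := fun q => simplexVol q s ^ 2) x₀ (hg s hs).2
      (vertexImageCLM n N).hasFDerivAt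
  have hev : (fun x : EuclideanSpace ℝ (Fin n × Fin N) =>
      M.energyV ρ (Matrix.of fun i a => x (a, i))) =ᶠ[nhds x₀] fun x =>
      ∑ s ∈ M.simplices n, simplexVol (vertexImageCLM n N x) s ^ 2 * (M.mass ρ s)⁻¹ := by
    -- Nondegeneracy persists near `x₀` because the squared volumes are continuous there and the
    -- simplices are finitely many; `energyV_eq` then applies throughout a neighbourhood.
    have hnear : ∀ᶠ x in nhds x₀, ∀ s ∈ M.simplices n,
        simplexVol (vertexImageCLM n N x) s ^ 2 ≠ 0 := by
      rw [Filter.eventually_all_finset]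
      exact fun s hs => (hder s hs).continuousAt.eventually_ne (pow_ne_zero 2 (hV s hs))
    filter_upwards [hnear] with x hx
    exact M.energyV_eq ρ hn fun s hs => (pow_ne_zero_iff two_ne_zero).1 (hx s hs)
  have hsum := HasFDerivAt.fun_sum fun s hs => (hder s hs).mul_const (M.mass ρ s)⁻¹
  rw [hasGradientAt_iff_hasFDerivAt]
  refine (hsum.congr_of_eventuallyEq hev).congr_fderiv ?_
  ext h
  have hinner : ∀ s i, ⟪g s i, vertexImageCLM n N h i⟫ = ∑ a, g s i a * h (a, i) := by
    intro s i
    rw [PiLp.inner_apply]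
    exact Finset.sum_congr rfl fun a _ => mul_comm _ _
  -- The claimed gradient is regrouped by vertex and simplex, to be matched term by term with the
  -- derivative after exchanging the sums.
  have hR : ⟪WithLp.toLp 2 (Matrix.vec ((2 : ℝ) • (M.laplacianV ρ f * f))), h⟫ =
      ∑ i, ∑ s ∈ M.simplices n, if i ∈ s then ∑ a,
        2 * (simplexVol (vertexImage f) s ^ 2 / M.mass ρ s) * (g s i a * h (a, i)) else 0 := by
    rw [PiLp.inner_apply, Fintype.sum_prod_type_right]
    refine Finset.sum_congr rfl fun i _ => ?_
    rw [← Finset.sum_filter, Finset.sum_comm]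
    refine Finset.sum_congr rfl fun a _ => ?_
    change h (a, i) * (2 * (M.laplacianV ρ f * f) i a) = _
    rw [M.laplacianV_mul_apply_eq ρ hn hV fun s hs => (hg s hs).1, Finset.mul_sum, Finset.mul_sum]
    refine Finset.sum_congr rfl fun s _ => by ring
  rw [InnerProductSpace.toDual_apply_apply, hR, Finset.sum_comm, sum_apply]
  refine Finset.sum_congr rfl fun s _ => ?_
  rw [← Finset.sum_filter, Finset.filter_univ_mem]
  simp only [smul_apply, ContinuousLinearMap.comp_apply, sum_apply,
    ContinuousLinearMap.proj_apply, innerSL_apply_apply, hinner, smul_eq_mul, Finset.mul_sum]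
  refine Finset.sum_congr rfl fun i _ => Finset.sum_congr rfl fun a _ => by ring
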